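/- For integers $a$ and $b\ge 0$, let ${a\brack b}$ denote the $q$-binomial coefficient, that is, the rational function in the indeterminate $q$ $${a\brack b}=\prod_{i=1}^{b}\frac{1-q^{a-b+i}}{1-q^i}\quad\text{if } 0\le b\le a,\qquad {a\brack b}=0\quad\text{otherwise.}$$ Let $m$ and $n$ be positive integers and let $j$, $k$ be non-negative integers. Then $$\frac{(1-q^{n-k})(1-q^{k+1})}{(1-q)(1-q^n)}{n+k\brack 2k}{m+1\brack k+1}{m+k\brack k+1}$$ and $$\frac{1-q}{1-q^{k+1}}{n-1\brack k}{n+k\brack k}{2k\brack j+k}{m+k\brack 2k}{m\brack j}{m+j\brack j}$$ are polynomials in $q$ with non-negative integer coefficients. -/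

import Mathlib

noncomputable section

/-- The `q`-binomial coefficient `[n, k]`, an element of the field `ℚ(q)` of rational functions
in the indeterminate `q = RatFunc.X`: the product of `(1 - q ^ (n - k + i)) / (1 - q ^ i)` over
`1 ≤ i ≤ k` if `k ≤ n`, and `0` otherwise. -/
def qBinom (n k : ℕ) : RatFunc ℚ :=
  if k ≤ n then
    ∏ i ∈ Finset.Icc 1 k,
      (1 - (RatFunc.X : RatFunc ℚ) ^ (n - k + i)) / (1 - (RatFunc.X : RatFunc ℚ) ^ i)
  else 0

/-- The rational function `f` is a polynomial in `q` with non-negative integer coefficients. -/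
def IsNonnegIntPolynomial (f : RatFunc ℚ) : Prop :=
  ∃ P : Polynomial ℤ, (∀ i : ℕ, 0 ≤ P.coeff i) ∧
    f = algebraMap (Polynomial ℚ) (RatFunc ℚ) (P.map (Int.castRingHom ℚ))

end

/-! ### Gaussian binomials as polynomials, and their zeros at roots of unity. -/

section

open Polynomial

/-! For k < n in the first case, both expressions have the form F = (1 - q) p / (1 - q^r), where r
is n or k + 1 and p is a product of Gaussian binomials and q-integers.

F is a polynomial because p vanishes at every primitive d-th root of unity with 1 < d ∣ r
(`exists_mul_one_sub_X_pow_eq`): [a, b] vanishes there once a mod d < b mod d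
(`gaussPoly_eval_eq_zero`), and comparing residues shows that some factor of p vanishes.

F has non-negative coefficients because p is, up to a shift, symmetric unimodal: Gaussian binomials
are, by Sylvester's theorem, and products preserve this (`mul_mem_symmUnimodal`). So the
coefficients of (1 - q) p are ≥ 0 up to the centre and ≤ 0 beyond. Those of F are their partial sums
along classes mod r: they rise from 0, then fall, and end at 0
(`coeff_nonneg_of_mul_one_sub_X_pow`). Sylvester's theorem itself follows from an sl₂ commutation
relation on functions of k-subsets of {0, …, N}. -/

lemma Nat.succ_mod_eq_of_ne_zero {a d : ℕ} (hd : 0 < d) (h : (a + 1) % d ≠ 0) :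
    (a + 1) % d = a % d + 1 := by
  have h1 := Nat.mod_lt a hd
  have h2 := Nat.div_add_mod a d
  have h3 : (a + 1) % d = (a % d + 1) % d := by simp
  rcases Nat.lt_or_ge (a % d + 1) d with h4 | h4
  · rw [h3, Nat.mod_eq_of_lt h4]
  · rw [h3, show a % d + 1 = d by omega, Nat.mod_self] at h
    exact absurd rfl h

/-- The Gaussian binomial coefficient as a polynomial, defined by the `q`-Pascal rule. -/
noncomputable def gaussPoly (R : Type*) [CommRing R] : ℕ → ℕ → R[X]
  | _, 0 => 1
  | 0, _ + 1 => 0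
  | n + 1, k + 1 => gaussPoly R n k + X ^ (k + 1) * gaussPoly R n (k + 1)

section GaussPoly

variable {R : Type*} [CommRing R]

@[simp] lemma gaussPoly_zero_right (n : ℕ) : gaussPoly R n 0 = 1 := by
  cases n <;> rfl

@[simp] lemma gaussPoly_zero_succ (k : ℕ) : gaussPoly R 0 (k + 1) = 0 := rfl

lemma gaussPoly_succ_succ (n k : ℕ) : gaussPoly R (n + 1) (k + 1) =
    gaussPoly R n k + X ^ (k + 1) * gaussPoly R n (k + 1) := rfl

lemma map_gaussPoly {S : Type*} [CommRing S] (f : R →+* S) (n k : ℕ) :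
    (gaussPoly R n k).map f = gaussPoly S n k := by
  induction n generalizing k with
  | zero => cases k <;> simp
  | succ n ih => cases k <;> simp [gaussPoly_succ_succ, ih]

lemma gaussPoly_eq_zero_of_lt {n k : ℕ} (h : n < k) : gaussPoly R n k = 0 := by
  induction n generalizing k with
  | zero => cases k with
    | zero => omega
    | succ k => rfl
  | succ n ih => cases k with
    | zero => omega
    | succ k => rw [gaussPoly_succ_succ, ih (by omega), ih (by omega)]; simp

lemma one_sub_X_pow_mul_gaussPoly (n k : ℕ) :
    (1 - X ^ (k + 1)) * gaussPoly R (n + 1) (k + 1) = (1 - X ^ (n + 1)) * gaussPoly R n k := by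
  induction n generalizing k with
  | zero => cases k <;> simp [gaussPoly_succ_succ]
  | succ n ih =>
    cases k with
    | zero =>
      have h := ih 0
      rw [gaussPoly_succ_succ (n + 1) 0]
      simp only [gaussPoly_zero_right, zero_add] at h ⊢
      linear_combination X ^ 1 * h
    | succ k =>
      have h1 := ih (k + 1)
      have h2 := ih k
      have h3 := gaussPoly_succ_succ (R := R) n k
      rw [gaussPoly_succ_succ (n + 1) (k + 1)]
      linear_combination X ^ (k + 2) * h1 + X * h2 - X * (1 - X ^ (n + 1)) * h3

/-- The second `q`-Pascal rule. -/
lemma X_pow_mul_gaussPoly_succ_succ (n k : ℕ) : X ^ k * gaussPoly R (n + 1) (k + 1) =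
    X ^ k * gaussPoly R n (k + 1) + X ^ n * gaussPoly R n k := by
  have h1 := one_sub_X_pow_mul_gaussPoly (R := R) n k
  have h2 := gaussPoly_succ_succ (R := R) n k
  refine monic_X.isRegular.left ?_
  change X * _ = X * _
  linear_combination h2 - h1

/-- Evaluating a Gaussian binomial at a primitive `d`-th root of unity gives zero as soon as
the residues modulo `d` of its arguments are in the wrong order. -/
lemma gaussPoly_eval_eq_zero {K : Type*} [Field K] {ζ : K} {d : ℕ} (hζ : IsPrimitiveRoot ζ d)
    (hd : 0 < d) {a b : ℕ} (h : a % d < b % d) : (gaussPoly K a b).eval ζ = 0 := by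
  induction a generalizing b with
  | zero =>
    cases b with
    | zero => simp at h
    | succ b => simp
  | succ a ih =>
    cases b with
    | zero => simp at h
    | succ b =>
      have hb : (b + 1) % d = b % d + 1 :=
        Nat.succ_mod_eq_of_ne_zero hd (by omega)
      -- If d ∣ a + 1, the absorption identity has right side 0 and left factor 1 - ζ^(b+1) ≠ 0.
      -- Otherwise both terms of the Pascal rule again have residues in the wrong order.
      by_cases ha : d ∣ a + 1
      · have h1 := congrArg (eval ζ) (one_sub_X_pow_mul_gaussPoly (R := K) a b)
        have h2 : ζ ^ (a + 1) = 1 := (hζ.pow_eq_one_iff_dvd _).2 ha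
        have h3 : ζ ^ (b + 1) ≠ 1 := fun h3 => by
          have := (hζ.pow_eq_one_iff_dvd _).1 h3
          have := Nat.mod_eq_zero_of_dvd this
          omega
        simp only [eval_mul, eval_sub, eval_one, eval_pow, eval_X, h2, sub_self, zero_mul] at h1
        exact (mul_eq_zero.1 h1).resolve_left (sub_ne_zero.2 (Ne.symm h3))
      · have ha' : (a + 1) % d = a % d + 1 :=
          Nat.succ_mod_eq_of_ne_zero hd (mt Nat.dvd_of_mod_eq_zero ha)
        rw [gaussPoly_succ_succ, eval_add, eval_mul, ih (by omega), ih (by omega)]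
        simp

end GaussPoly

lemma RatFunc.one_sub_X_pow_ne_zero {K : Type*} [Field K] {n : ℕ} (hn : n ≠ 0) :
    (1 - (RatFunc.X : RatFunc K) ^ n) ≠ 0 := by
  have h : (1 - Polynomial.X ^ n : K[X]) ≠ 0 := fun h => by
    have := congrArg (coeff · 0) h
    simp [coeff_X_pow, hn.symm] at this
  have h2 := (map_ne_zero_iff (algebraMap K[X] (RatFunc K))
    (RatFunc.algebraMap_injective K)).2 h
  simpa using h2

lemma qBinom_zero_right (n : ℕ) : qBinom n 0 = 1 := by simp [qBinom]

lemma qBinom_succ_succ (n k : ℕ) : (1 - (RatFunc.X : RatFunc ℚ) ^ (k + 1)) *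
    qBinom (n + 1) (k + 1) = (1 - (RatFunc.X : RatFunc ℚ) ^ (n + 1)) * qBinom n k := by
  unfold qBinom
  by_cases h : k ≤ n
  · rw [if_pos h, if_pos (by omega), Finset.prod_Icc_succ_top (by omega)]
    have h0 := RatFunc.one_sub_X_pow_ne_zero (K := ℚ) (Nat.succ_ne_zero k)
    rw [show n + 1 - (k + 1) = n - k by omega, show n - k + (k + 1) = n + 1 by omega]
    field_simp
  · rw [if_neg h, if_neg (by omega)]; simp

lemma qBinom_eq_algebraMap (n k : ℕ) :
    qBinom n k = algebraMap ℚ[X] (RatFunc ℚ) (gaussPoly ℚ n k) := by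
  induction n generalizing k with
  | zero =>
    cases k with
    | zero => simp [qBinom_zero_right]
    | succ k => simp [qBinom]
  | succ n ih =>
    cases k with
    | zero => simp [qBinom_zero_right]
    | succ k =>
      refine mul_left_cancel₀ (RatFunc.one_sub_X_pow_ne_zero (Nat.succ_ne_zero k)) ?_
      have h := congrArg (algebraMap ℚ[X] (RatFunc ℚ)) (one_sub_X_pow_mul_gaussPoly (R := ℚ) n k)
      simp only [map_mul, map_sub, map_one, map_pow, RatFunc.algebraMap_X] at h
      rw [Nat.succ_eq_add_one, h, qBinom_succ_succ, ih]

end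

/-! ### Symmetric unimodal polynomials. -/

section

open Polynomial

/-- The cone of symmetric unimodal integer polynomials with centre of symmetry `N / 2`. -/
noncomputable def symmUnimodal (N : ℕ) : AddSubmonoid ℤ[X] :=
  AddSubmonoid.closure {p | ∃ i a : ℕ, 2 * i + a = N ∧ p = X ^ i * ∑ l ∈ Finset.range (a + 1), X ^ l}

lemma X_pow_mul_geom_mem_symmUnimodal {N i a : ℕ} (h : 2 * i + a = N) :
    X ^ i * ∑ l ∈ Finset.range (a + 1), X ^ l ∈ symmUnimodal N :=
  AddSubmonoid.subset_closure ⟨i, a, h, rfl⟩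

lemma geom_mem_symmUnimodal (a : ℕ) :
    ∑ l ∈ Finset.range (a + 1), X ^ l ∈ symmUnimodal a := by
  simpa using X_pow_mul_geom_mem_symmUnimodal (N := a) (i := 0) (a := a) (by simp)

lemma X_pow_mul_mem_symmUnimodal {N : ℕ} {p : ℤ[X]} (hp : p ∈ symmUnimodal N) (c : ℕ) :
    X ^ c * p ∈ symmUnimodal (2 * c + N) := by
  induction hp using AddSubmonoid.closure_induction with
  | mem p hp =>
    obtain ⟨i, a, h, rfl⟩ := hp
    rw [← mul_assoc, ← pow_add]
    exact X_pow_mul_geom_mem_symmUnimodal (by omega)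
  | zero => simp [zero_mem]
  | add p q _ _ hp hq => rw [mul_add]; exact add_mem hp hq

/-- Clebsch–Gordan rule: with q-integers, [a+2][b+2] = [a+b+3] + q [a+1][b+1]. -/
lemma geom_mul_geom_mem_symmUnimodal (a b : ℕ) :
    (∑ l ∈ Finset.range (a + 1), X ^ l) * (∑ l ∈ Finset.range (b + 1), X ^ l) ∈
      symmUnimodal (a + b) := by
  induction a generalizing b with
  | zero => simpa using geom_mem_symmUnimodal b
  | succ a ih =>
    cases b with
    | zero => simpa using geom_mem_symmUnimodal (a + 1)
    | succ b =>
      have key : (∑ l ∈ Finset.range (a + 1 + 1), X ^ l) *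
          (∑ l ∈ Finset.range (b + 1 + 1), (X : ℤ[X]) ^ l) =
          ∑ l ∈ Finset.range (a + 1 + (b + 1) + 1), X ^ l + X ^ 1 *
          ((∑ l ∈ Finset.range (a + 1), X ^ l) * (∑ l ∈ Finset.range (b + 1), X ^ l)) := by
        have hX : (X - 1 : ℤ[X]) ≠ 0 := X_sub_C_ne_zero 1
        refine mul_right_cancel₀ hX (mul_right_cancel₀ hX ?_)
        have g := fun n => geom_sum_mul (X : ℤ[X]) n
        linear_combination (∑ l ∈ Finset.range (b + 1 + 1), X ^ l) * (X - 1) * g (a + 1 + 1)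
          + (X ^ (a + 1 + 1) - 1) * g (b + 1 + 1) - (X - 1) * g (a + 1 + (b + 1) + 1)
          - X * (∑ l ∈ Finset.range (b + 1), X ^ l) * (X - 1) * g (a + 1)
          - X * (X ^ (a + 1) - 1) * g (b + 1)
      rw [key]
      refine add_mem (geom_mem_symmUnimodal _) ?_
      convert X_pow_mul_mem_symmUnimodal (ih b) 1 using 1
      congr 1; omega

lemma mul_mem_symmUnimodal {M N : ℕ} {p q : ℤ[X]} (hp : p ∈ symmUnimodal M)
    (hq : q ∈ symmUnimodal N) : p * q ∈ symmUnimodal (M + N) := by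
  induction hp using AddSubmonoid.closure_induction with
  | zero => simp [zero_mem]
  | add p p' _ _ h h' => rw [add_mul]; exact add_mem h h'
  | mem p hp =>
    obtain ⟨i, a, h, rfl⟩ := hp
    induction hq using AddSubmonoid.closure_induction with
    | zero => simp [zero_mem]
    | add q q' _ _ h h' => rw [mul_add]; exact add_mem h h'
    | mem q hq =>
      obtain ⟨j, b, h', rfl⟩ := hq
      convert X_pow_mul_mem_symmUnimodal (geom_mul_geom_mem_symmUnimodal a b) (i + j) using 1
      · congr 1; omega
      · ring

/-- The differences of a symmetric unimodal polynomial change sign at its centre. -/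
lemma coeff_one_sub_X_mul_of_mem_symmUnimodal {N : ℕ} {p : ℤ[X]} (hp : p ∈ symmUnimodal N)
    (i : ℕ) : (2 * i ≤ N + 1 → 0 ≤ ((1 - X) * p).coeff i) ∧
      (N + 1 ≤ 2 * i → ((1 - X) * p).coeff i ≤ 0) := by
  induction hp using AddSubmonoid.closure_induction with
  | zero => simp
  | add p q _ _ hp hq =>
    rw [mul_add, coeff_add]
    exact ⟨fun h => add_nonneg (hp.1 h) (hq.1 h), fun h => add_nonpos (hp.2 h) (hq.2 h)⟩
  | mem p hp =>
    obtain ⟨j, a, h, rfl⟩ := hp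
    -- The two exponents sum to N + 1, so they lie on opposite sides of the centre.
    have key : (1 - X) * (X ^ j * ∑ l ∈ Finset.range (a + 1), (X : ℤ[X]) ^ l) =
        X ^ j - X ^ (j + a + 1) := by
      linear_combination -X ^ j * geom_sum_mul (X : ℤ[X]) (a + 1)
    rw [key, coeff_sub, coeff_X_pow, coeff_X_pow]
    constructor <;> intro h' <;> split_ifs <;> omega

/-- A polynomial whose coefficients are symmetric about `N / 2` and weakly increasing up to there
is symmetric unimodal. -/
lemma mem_symmUnimodal_of_coeff {N : ℕ} {p : ℤ[X]} (h0 : 0 ≤ p.coeff 0)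
    (hsymm : ∀ i j, i + j = N → p.coeff i = p.coeff j) (hdeg : ∀ i, N < i → p.coeff i = 0)
    (hmono : ∀ i, 2 * i < N → p.coeff i ≤ p.coeff (i + 1)) : p ∈ symmUnimodal N := by
  -- The multiplicity of the generator starting at X^i is the jump p_i - p_(i-1). After
  -- multiplication by 1 - X each generator telescopes to X^i - X^(N+1-i).
  have key : p = ∑ i ∈ Finset.range (N / 2 + 1),
      (((1 - X) * p).coeff i).toNat • (X ^ i * ∑ l ∈ Finset.range (N - 2 * i + 1), X ^ l) := by
    have hX : (1 - X : ℤ[X]) ≠ 0 := by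
      rw [← neg_sub]; exact neg_ne_zero.2 (X_sub_C_ne_zero 1)
    refine mul_left_cancel₀ hX ?_
    have hc : ∀ i, ((1 - X) * p).coeff i = p.coeff i - if i = 0 then 0 else p.coeff (i - 1) := by
      intro i
      rw [sub_mul, one_mul, coeff_sub]
      cases i <;> simp
    have hnn : ∀ i ∈ Finset.range (N / 2 + 1), 0 ≤ ((1 - X) * p).coeff i := by
      intro i hi
      have hi := Finset.mem_range.1 hi
      rw [hc]
      cases i with
      | zero => simpa using h0
      | succ i => simpa using hmono i (by omega)
    have hterm : ∀ i ∈ Finset.range (N / 2 + 1), (1 - X) * ((((1 - X) * p).coeff i).toNat •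
        (X ^ i * ∑ l ∈ Finset.range (N - 2 * i + 1), (X : ℤ[X]) ^ l)) =
        C (((1 - X) * p).coeff i) * X ^ i - C (((1 - X) * p).coeff i) * X ^ (N + 1 - i) := by
      intro i hi
      have hi' := Finset.mem_range.1 hi
      rw [nsmul_eq_mul, ← Int.cast_natCast, Int.toNat_of_nonneg (hnn i hi),
        show N + 1 - i = i + (N - 2 * i + 1) by omega, pow_add, ← C_eq_intCast]
      have := geom_sum_mul (X : ℤ[X]) (N - 2 * i + 1)
      simp only [Int.cast_id]
      linear_combination -C (((1 - X) * p).coeff i) * X ^ i * this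
    rw [Finset.mul_sum, Finset.sum_congr rfl hterm]
    ext j
    rw [finsetSum_coeff]
    simp only [coeff_sub, coeff_C_mul, coeff_X_pow, mul_ite, mul_one, mul_zero,
      Finset.sum_sub_distrib, Finset.sum_ite_eq, Finset.mem_range]
    by_cases hj : j < N / 2 + 1
    · rw [if_pos hj, Finset.sum_eq_zero, sub_zero]
      intro i hi
      have := Finset.mem_range.1 hi
      rw [if_neg (by omega)]
    · rw [if_neg hj]
      by_cases hjN : j ≤ N + 1
      · by_cases hj2 : 2 * j = N + 1
        · rw [Finset.sum_eq_zero, sub_zero, hc, if_neg (by omega),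
            hsymm j (j - 1) (by omega), sub_self]
          intro i hi
          have := Finset.mem_range.1 hi
          rw [if_neg (by omega)]
        · rw [Finset.sum_eq_single_of_mem (N + 1 - j) (Finset.mem_range.2 (by omega)),
            if_pos (by omega), hc, hc, if_neg (by omega), hsymm (j - 1) (N + 1 - j) (by omega)]
          · split_ifs with h
            · rw [hdeg j (by omega), sub_zero]
            · rw [hsymm j (N + 1 - j - 1) (by omega)]; ring
          · intro i hi hne
            rw [if_neg (by omega)]
      · rw [Finset.sum_eq_zero, hc, if_neg (by omega), hdeg j (by omega), hdeg (j - 1) (by omega)]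
        intro i hi
        have := Finset.mem_range.1 hi
        rw [if_neg (by omega)]
  rw [key]
  refine sum_mem fun i hi => nsmul_mem (X_pow_mul_geom_mem_symmUnimodal ?_) _
  have := Finset.mem_range.1 hi
  omega

/-- If `(1 - q) p / (1 - q ^ n)` is a polynomial, where a shift of `p` is symmetric unimodal, then
it has nonnegative coefficients. -/
lemma coeff_nonneg_of_mul_one_sub_X_pow {N c n : ℕ} (hn : 0 < n) {F p : ℤ[X]}
    (hp : X ^ c * p ∈ symmUnimodal N) (h : F * (1 - X ^ n) = (1 - X) * p) (i : ℕ) :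
    0 ≤ F.coeff i := by
  have hd := coeff_one_sub_X_mul_of_mem_symmUnimodal hp
  have e : ∀ i, ((1 - X) * (X ^ c * p)).coeff (i + n) =
      (X ^ c * F).coeff (i + n) - (X ^ c * F).coeff i := by
    intro i
    rw [show (1 - X) * (X ^ c * p) = X ^ c * F - X ^ c * F * X ^ n by
      linear_combination -X ^ c * h, coeff_sub, coeff_mul_X_pow]
  have e' : ∀ i < n, ((1 - X) * (X ^ c * p)).coeff i = (X ^ c * F).coeff i := by
    intro i hi
    rw [show (1 - X) * (X ^ c * p) = X ^ c * F - X ^ c * F * X ^ n by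
      linear_combination -X ^ c * h, coeff_sub, coeff_mul_X_pow', if_neg (by omega), sub_zero]
  have main : ∀ i, 0 ≤ (X ^ c * F).coeff i := by
    intro i
    by_cases hi : 2 * i ≤ N + 1
    · induction i using Nat.strong_induction_on with
      | _ i ih =>
        by_cases hin : i < n
        · rw [← e' i hin]; exact (hd i).1 hi
        · have h1 := e (i - n)
          have h2 := ih (i - n) (by omega) (by omega)
          rw [Nat.sub_add_cancel (by omega)] at h1
          have := (hd i).1 hi
          omega
    -- Past the centre the coefficients do not increase in steps of n, so a negative one would stay
    -- negative beyond the degree.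
    · by_contra! hneg
      have hall : ∀ t : ℕ, (X ^ c * F).coeff (i + t * n) < 0 := by
        intro t
        induction t with
        | zero => simpa using hneg
        | succ t ih =>
          have h1 := e (i + t * n)
          have h2 := (hd (i + t * n + n)).2 (by nlinarith)
          rw [show i + (t + 1) * n = i + t * n + n by ring]
          omega
      have h1 := hall ((X ^ c * F).natDegree + 1)
      rw [coeff_eq_zero_of_natDegree_lt (by nlinarith)] at h1
      exact lt_irrefl _ h1
  simpa [coeff_X_pow_mul] using main (i + c)

end

/-! ### Sylvester's theorem by raising and lowering operators. -/

section

open Polynomial Finset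

/-- Exchange the membership of `i` and `i + 1` in a finite set. -/
def swapSucc (i : ℕ) : Finset ℕ ≃ Finset ℕ := (Equiv.swap i (i + 1)).finsetCongr

lemma mem_swapSucc {i x : ℕ} {S : Finset ℕ} :
    x ∈ swapSucc i S ↔ Equiv.swap i (i + 1) x ∈ S := by
  simp [swapSucc, Equiv.finsetCongr_apply, Finset.mem_map_equiv]

lemma left_mem_swapSucc {i : ℕ} {S : Finset ℕ} : i ∈ swapSucc i S ↔ i + 1 ∈ S := by
  simp [mem_swapSucc]

lemma right_mem_swapSucc {i : ℕ} {S : Finset ℕ} : i + 1 ∈ swapSucc i S ↔ i ∈ S := by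
  simp [mem_swapSucc]

lemma mem_swapSucc_of_ne {i x : ℕ} {S : Finset ℕ} (h : x ≠ i) (h' : x ≠ i + 1) :
    x ∈ swapSucc i S ↔ x ∈ S := by
  rw [mem_swapSucc, Equiv.swap_apply_of_ne_of_ne h h']

lemma swapSucc_swapSucc (i : ℕ) (S : Finset ℕ) : swapSucc i (swapSucc i S) = S := by
  ext x; simp [mem_swapSucc]

lemma swapSucc_comm {i j : ℕ} (h : i + 1 < j) (S : Finset ℕ) :
    swapSucc i (swapSucc j S) = swapSucc j (swapSucc i S) := by
  ext x
  simp only [mem_swapSucc]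
  have : Equiv.swap j (j + 1) (Equiv.swap i (i + 1) x) =
      Equiv.swap i (i + 1) (Equiv.swap j (j + 1) x) := by
    simp only [Equiv.swap_apply_def]
    split_ifs <;> omega
  rw [this]

lemma swapSucc_mem_powersetCard {N k i : ℕ} (hi : i < N) {S : Finset ℕ} :
    S ∈ powersetCard k (range (N + 1)) ↔ swapSucc i S ∈ powersetCard k (range (N + 1)) := by
  have key : ∀ S, S ∈ powersetCard k (range (N + 1)) →
      swapSucc i S ∈ powersetCard k (range (N + 1)) := by
    intro S hS
    rw [mem_powersetCard] at hS ⊢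
    refine ⟨fun x hx => ?_, by simpa [swapSucc] using hS.2⟩
    have := mem_range.1 (hS.1 (mem_swapSucc.1 hx))
    rw [Equiv.swap_apply_def] at this
    rw [mem_range]
    split_ifs at this <;> omega
  exact ⟨key S, fun h => by simpa [swapSucc_swapSucc] using key _ h⟩

lemma sum_swapSucc_add_one {i : ℕ} {S : Finset ℕ} (h : i ∉ S) (h' : i + 1 ∈ S) :
    ∑ x ∈ swapSucc i S, x + 1 = ∑ x ∈ S, x := by
  simp only [swapSucc, Equiv.finsetCongr_apply, sum_map, Equiv.coe_toEmbedding]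
  rw [← add_sum_erase _ _ h', ← add_sum_erase S (fun x => x) h', Equiv.swap_apply_right,
    sum_congr rfl (g := fun x => x)]
  · ring
  · intro x hx
    rw [mem_erase] at hx
    exact Equiv.swap_apply_of_ne_of_ne (by rintro rfl; exact h hx.2) hx.1

/-- The weighted operator moving one element of a set up by one, acting on functions. -/
noncomputable def raiseOp (N : ℕ) (c : ℕ → ℝ) (f : Finset ℕ → ℝ) (S : Finset ℕ) : ℝ :=
  ∑ i ∈ range N, if i ∉ S ∧ i + 1 ∈ S then c i * f (swapSucc i S) else 0

/-- The weighted operator moving one element of a set down by one, acting on functions. -/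
noncomputable def lowerOp (N : ℕ) (c : ℕ → ℝ) (f : Finset ℕ → ℝ) (S : Finset ℕ) : ℝ :=
  ∑ i ∈ range N, if i ∈ S ∧ i + 1 ∉ S then c i * f (swapSucc i S) else 0

/-- The off-diagonal part of the commutator vanishes. For j = i + 1 every term is 0; otherwise the
swaps commute, and S ↦ `swapSucc i (swapSucc j S)` exchanges the two sums. -/
lemma sum_raise_mul_raise_of_lt (N k : ℕ) (c : ℕ → ℝ) (f : Finset ℕ → ℝ) {i j : ℕ} (hij : i < j)
    (hj : j < N) :
    ∑ S ∈ powersetCard k (range (N + 1)),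
      (if i ∉ S ∧ i + 1 ∈ S then c i * f (swapSucc i S) else 0) *
      (if j ∉ S ∧ j + 1 ∈ S then c j * f (swapSucc j S) else 0) =
    ∑ S ∈ powersetCard k (range (N + 1)),
      (if i ∈ S ∧ i + 1 ∉ S then c i * f (swapSucc i S) else 0) *
      (if j ∈ S ∧ j + 1 ∉ S then c j * f (swapSucc j S) else 0) := by
  rcases (Nat.succ_le_of_lt hij).eq_or_lt with rfl | h
  · refine sum_congr rfl fun S _ => ?_
    by_cases h : i + 1 ∈ S <;> simp [h]
  · have h : i + 1 < j := h
    refine sum_equiv ((swapSucc j).trans (swapSucc i)) (fun S => ?_) (fun S _ => ?_)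
    · rw [Equiv.trans_apply, ← swapSucc_mem_powersetCard (by omega),
        ← swapSucc_mem_powersetCard hj]
    · have h1 : ∀ x, (x = i ∨ x = i + 1) → (x ∈ swapSucc j S ↔ x ∈ S) := fun x hx =>
        mem_swapSucc_of_ne (by omega) (by omega)
      have h2 : ∀ x, (x = j ∨ x = j + 1) → (x ∈ swapSucc i (swapSucc j S) ↔ x ∈ swapSucc j S) :=
        fun x hx => mem_swapSucc_of_ne (by omega) (by omega)
      simp only [Equiv.trans_apply, left_mem_swapSucc, right_mem_swapSucc, h2 j (by simp),
        h2 (j + 1) (by simp), h1 i (by simp), h1 (i + 1) (by simp)]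
      rw [swapSucc_swapSucc, ← swapSucc_comm h (swapSucc j S), swapSucc_swapSucc]
      simp only [and_comm (a := i ∉ S), and_comm (a := j ∉ S)]
      split_ifs <;> ring

/-- Reindexing by `swapSucc i` turns both squares into multiples of f(S)², leaving a difference of
indicators. -/
lemma sum_raise_sq_sub_sum_lower_sq (N k : ℕ) (c : ℕ → ℝ) (f : Finset ℕ → ℝ) {i : ℕ}
    (hi : i < N) :
    ∑ S ∈ powersetCard k (range (N + 1)),
      (if i ∉ S ∧ i + 1 ∈ S then c i * f (swapSucc i S) else 0) ^ 2 -
    ∑ S ∈ powersetCard k (range (N + 1)),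
      (if i ∈ S ∧ i + 1 ∉ S then c i * f (swapSucc i S) else 0) ^ 2 =
    ∑ S ∈ powersetCard k (range (N + 1)),
      f S ^ 2 * (c i ^ 2 * ((if i ∈ S then 1 else 0) - (if i + 1 ∈ S then 1 else 0))) := by
  have hu : ∑ S ∈ powersetCard k (range (N + 1)),
      (if i ∉ S ∧ i + 1 ∈ S then c i * f (swapSucc i S) else 0) ^ 2 =
      ∑ S ∈ powersetCard k (range (N + 1)), (if i ∈ S ∧ i + 1 ∉ S then c i * f S else 0) ^ 2 := by
    refine sum_equiv (swapSucc i) (fun S => swapSucc_mem_powersetCard hi) (fun S _ => ?_)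
    simp only [left_mem_swapSucc, right_mem_swapSucc, and_comm (a := i ∉ S)]
  have hd : ∑ S ∈ powersetCard k (range (N + 1)),
      (if i ∈ S ∧ i + 1 ∉ S then c i * f (swapSucc i S) else 0) ^ 2 =
      ∑ S ∈ powersetCard k (range (N + 1)), (if i ∉ S ∧ i + 1 ∈ S then c i * f S else 0) ^ 2 := by
    refine sum_equiv (swapSucc i) (fun S => swapSucc_mem_powersetCard hi) (fun S _ => ?_)
    simp only [left_mem_swapSucc, right_mem_swapSucc, and_comm (a := i ∈ S)]
  rw [hu, hd, ← sum_sub_distrib]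
  refine sum_congr rfl fun S _ => ?_
  by_cases h : i ∈ S <;> by_cases h' : i + 1 ∈ S <;> simp [h, h'] <;> ring

/-- The commutation relation of the raising and lowering operators, as quadratic forms. -/
lemma sum_raiseOp_sq_sub_sum_lowerOp_sq (N k : ℕ) (c : ℕ → ℝ) (f : Finset ℕ → ℝ) :
    ∑ S ∈ powersetCard k (range (N + 1)), raiseOp N c f S ^ 2 -
    ∑ S ∈ powersetCard k (range (N + 1)), lowerOp N c f S ^ 2 =
    ∑ S ∈ powersetCard k (range (N + 1)), f S ^ 2 * ∑ i ∈ range N,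
      c i ^ 2 * ((if i ∈ S then 1 else 0) - (if i + 1 ∈ S then 1 else 0)) := by
  have expand : ∀ t : ℕ → Finset ℕ → ℝ,
      ∑ S ∈ powersetCard k (range (N + 1)), (∑ i ∈ range N, t i S) ^ 2 =
      ∑ i ∈ range N, ∑ j ∈ range N, ∑ S ∈ powersetCard k (range (N + 1)), t i S * t j S := by
    intro t
    simp only [sq, sum_mul_sum]
    rw [sum_comm]
    exact sum_congr rfl fun i _ => sum_comm
  simp only [raiseOp, lowerOp, expand, mul_sum]
  rw [sum_comm (s := powersetCard k (range (N + 1))), ← sum_sub_distrib]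
  refine sum_congr rfl fun i hi => ?_
  rw [← sum_sub_distrib, sum_eq_single_of_mem i hi]
  · simp only [← sq]
    exact sum_raise_sq_sub_sum_lower_sq N k c f (mem_range.1 hi)
  · intro j hj hji
    rw [sub_eq_zero]
    rcases lt_or_gt_of_ne hji with h | h
    · have := sum_raise_mul_raise_of_lt N k c f h (mem_range.1 hi)
      simpa only [mul_comm] using this
    · exact sum_raise_mul_raise_of_lt N k c f h (mem_range.1 hj)

/-- Summation by parts: (x + 1)(N - x) - x(N + 1 - x) = N - 2x. This dictates the weights in the
operators. -/
lemma sum_weight_eq {N : ℕ} {S : Finset ℕ} (hS : S ⊆ range (N + 1)) :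
    ∑ i ∈ range N, ((i : ℝ) + 1) * (N - i) *
      ((if i ∈ S then 1 else 0) - (if i + 1 ∈ S then 1 else 0)) = ∑ x ∈ S, ((N : ℝ) - 2 * x) := by
  have h1 : ∑ i ∈ range N, ((i : ℝ) + 1) * (N - i) * (if i ∈ S then 1 else 0) =
      ∑ i ∈ range (N + 1), ((i : ℝ) + 1) * (N - i) * (if i ∈ S then 1 else 0) := by
    rw [sum_range_succ]; simp
  have h2 : ∑ i ∈ range N, ((i : ℝ) + 1) * (N - i) * (if i + 1 ∈ S then 1 else 0) =
      ∑ i ∈ range (N + 1), (i : ℝ) * (N + 1 - i) * (if i ∈ S then 1 else 0) := by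
    rw [sum_range_succ']
    simp
  simp only [mul_sub _ (ite _ _ _), sum_sub_distrib (s := range N)]
  rw [h1, h2, ← sum_sub_distrib, ← sum_subset hS]
  · refine sum_congr rfl fun x hx => ?_
    rw [if_pos hx]; ring
  · intro x _ hx
    rw [if_neg hx]; ring

/-- The number of `k`-subsets of `{0, …, N}` with given sum increases up to the middle. -/
lemma card_powersetCard_filter_sum_le {N k s : ℕ} (hs : 2 * s < k * N) :
    #{S ∈ powersetCard k (range (N + 1)) | ∑ x ∈ S, x = s} ≤
      #{S ∈ powersetCard k (range (N + 1)) | ∑ x ∈ S, x = s + 1} := by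
  classical
  set A := {S ∈ powersetCard k (range (N + 1)) | ∑ x ∈ S, x = s} with hA
  set B := {S ∈ powersetCard k (range (N + 1)) | ∑ x ∈ S, x = s + 1} with hB
  let c : ℕ → ℝ := fun i => √(((i : ℝ) + 1) * (N - i))
  have hc : ∀ i ∈ range N, c i ^ 2 = ((i : ℝ) + 1) * (N - i) := by
    intro i hi
    have : (i : ℝ) < N := by exact_mod_cast mem_range.1 hi
    exact Real.sq_sqrt (mul_nonneg (by positivity) (by linarith))
  let ext (g : A → ℝ) (S : Finset ℕ) : ℝ := if h : S ∈ A then g ⟨S, h⟩ else 0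
  let L : (A → ℝ) →ₗ[ℝ] (B → ℝ) :=
    { toFun := fun g S => raiseOp N c (ext g) S
      map_add' := by
        intro g g'
        funext S
        simp only [raiseOp, Pi.add_apply, ← sum_add_distrib, ext]
        refine sum_congr rfl fun i _ => ?_
        split_ifs <;> ring
      map_smul' := by
        intro r g
        funext S
        simp only [raiseOp, Pi.smul_apply, smul_eq_mul, mul_sum, ext, RingHom.id_apply]
        refine sum_congr rfl fun i _ => ?_
        split_ifs <;> ring }
  have hL : Function.Injective L := by
    refine (injective_iff_map_eq_zero L).2 fun g hg => ?_
    have hraise : ∀ S ∈ powersetCard k (range (N + 1)), raiseOp N c (ext g) S = 0 := by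
      intro S hS
      by_cases hSB : S ∈ B
      · exact congrFun hg ⟨S, hSB⟩
      · refine sum_eq_zero fun i hi => ?_
        split_ifs with h
        · have : swapSucc i S ∉ A := by
            intro hmem
            have := sum_swapSucc_add_one h.1 h.2
            rw [(mem_filter.1 hmem).2] at this
            exact hSB (mem_filter.2 ⟨hS, this.symm⟩)
          simp [ext, this]
        · rfl
    -- For g supported on sets of sum s this reads ‖raise g‖² - ‖lower g‖² = (kN - 2s) ‖g‖², and kN
    -- - 2s > 0, so raise g = 0 forces g = 0.
    have key := sum_raiseOp_sq_sub_sum_lowerOp_sq N k c (ext g)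
    have hterm : ∀ S ∈ powersetCard k (range (N + 1)), ext g S ^ 2 * ∑ i ∈ range N,
        c i ^ 2 * ((if i ∈ S then 1 else 0) - (if i + 1 ∈ S then 1 else 0)) =
        ext g S ^ 2 * (k * N - 2 * s) := by
      intro S hS
      by_cases hSA : S ∈ A
      · have hS' := mem_powersetCard.1 hS
        have hsum : ((∑ x ∈ S, x : ℕ) : ℝ) = s := congrArg _ (mem_filter.1 hSA).2
        rw [sum_congr rfl (fun i hi => by rw [hc i hi]), sum_weight_eq hS'.1, sum_sub_distrib,
          ← mul_sum, sum_const, hS'.2, nsmul_eq_mul, ← hsum, Nat.cast_sum]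
      · simp [ext, hSA]
    rw [sum_congr rfl hterm, ← sum_mul, sum_congr rfl (fun S hS => by rw [hraise S hS])] at key
    have hpos : (0 : ℝ) < k * N - 2 * s := by
      have : ((2 * s : ℕ) : ℝ) < (k * N : ℕ) := by exact_mod_cast hs
      push_cast at this
      linarith
    have hlow : 0 ≤ ∑ S ∈ powersetCard k (range (N + 1)), lowerOp N c (ext g) S ^ 2 :=
      sum_nonneg fun S _ => sq_nonneg _
    have hnn : ∀ S ∈ powersetCard k (range (N + 1)), 0 ≤ ext g S ^ 2 := fun S _ => sq_nonneg _
    have hzero : ∑ S ∈ powersetCard k (range (N + 1)), ext g S ^ 2 = 0 := by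
      refine le_antisymm ?_ (sum_nonneg hnn)
      simp only [ne_eq, OfNat.ofNat_ne_zero, not_false_eq_true, zero_pow, sum_const_zero] at key
      nlinarith
    funext S
    have := (sum_eq_zero_iff_of_nonneg hnn).1 hzero S (mem_filter.1 S.2).1
    simpa [ext] using this
  simpa using LinearMap.finrank_le_finrank_of_injective hL

/-- The reflection x ↦ N - x turns a sum s into kN - s. -/
lemma card_powersetCard_filter_sum_symm {N k s t : ℕ} (h : s + t = k * N) :
    #{S ∈ powersetCard k (range (N + 1)) | ∑ x ∈ S, x = s} =
      #{S ∈ powersetCard k (range (N + 1)) | ∑ x ∈ S, x = t} := by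
  have hinj : ∀ S ⊆ range (N + 1), Set.InjOn (fun x => N - x) (S : Set ℕ) := by
    intro S hS x hx y hy hxy
    have := mem_range.1 (hS hx)
    have := mem_range.1 (hS hy)
    simp only at hxy
    omega
  have hinv : ∀ S ⊆ range (N + 1), (S.image (fun x => N - x)).image (fun x => N - x) = S := by
    intro S hS
    rw [image_image]
    conv_rhs => rw [← image_id (s := S)]
    refine image_congr fun x hx => ?_
    have := mem_range.1 (hS hx)
    simp only [Function.comp_apply, id]
    omega
  have hmem : ∀ s t, s + t = k * N → ∀ S,
      S ∈ {S ∈ powersetCard k (range (N + 1)) | ∑ x ∈ S, x = s} →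
      S.image (fun x => N - x) ∈ {S ∈ powersetCard k (range (N + 1)) | ∑ x ∈ S, x = t} := by
    intro s t h S hS
    obtain ⟨hS, hsum⟩ := mem_filter.1 hS
    obtain ⟨hsub, hcard⟩ := mem_powersetCard.1 hS
    refine mem_filter.2 ⟨mem_powersetCard.2 ⟨fun y hy => ?_, ?_⟩, ?_⟩
    · obtain ⟨x, _, rfl⟩ := mem_image.1 hy
      exact mem_range.2 (by omega)
    · rw [card_image_of_injOn (hinj S hsub), hcard]
    · rw [sum_image (hinj S hsub)]
      have : ∑ x ∈ S, (N - x) + ∑ x ∈ S, x = k * N := by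
        rw [← sum_add_distrib, sum_congr rfl (g := fun _ => N), sum_const, hcard, smul_eq_mul]
        intro x hx
        have := mem_range.1 (hsub hx)
        omega
      omega
  refine card_nbij' (fun S => S.image (fun x => N - x)) (fun S => S.image (fun x => N - x))
    (hmem s t h) (hmem t s (by omega)) ?_ ?_ <;>
  · intro S hS
    exact hinv S (mem_powersetCard.1 (mem_filter.1 hS).1).1

/-- The generating polynomial of `k`-subsets of `{0, …, n - 1}` by their sum. -/
lemma sum_powersetCard_X_pow_sum {R : Type*} [CommRing R] (n k : ℕ) :
    ∑ S ∈ powersetCard k (range n), (X : R[X]) ^ (∑ x ∈ S, x) =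
      X ^ (k.choose 2) * gaussPoly R n k := by
  induction n generalizing k with
  | zero =>
    cases k with
    | zero => simp
    | succ k => rw [powersetCard_eq_empty.2 (by simp)]; simp
  | succ n ih =>
    cases k with
    | zero => simp
    | succ k =>
      have hn : n ∉ range n := by simp
      -- Splitting by whether n ∈ S reproduces the second Pascal rule.
      rw [range_add_one, powersetCard_succ_insert hn, sum_union, sum_image, ih,
        sum_congr rfl (g := fun S => X ^ n * X ^ (∑ x ∈ S, x)), ← mul_sum, ih,
        Nat.choose_succ_succ' k 1, Nat.choose_one_right, pow_add]
      · linear_combination -X ^ (k.choose 2) * X_pow_mul_gaussPoly_succ_succ (R := R) n k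
      · intro S hS
        rw [sum_insert fun h => hn ((mem_powersetCard.1 hS).1 h), pow_add]
      · intro S hS S' hS' h
        have h1 : n ∉ S := fun h => hn ((mem_powersetCard.1 hS).1 h)
        have h2 : n ∉ S' := fun h => hn ((mem_powersetCard.1 hS').1 h)
        rw [← erase_insert h1, ← erase_insert h2, h]
      · rw [disjoint_left]
        intro S hS hS'
        obtain ⟨S', _, rfl⟩ := mem_image.1 hS'
        exact hn ((mem_powersetCard.1 hS).1 (mem_insert_self _ _))

/-- **Sylvester's theorem**: Gaussian binomials are symmetric unimodal, up to a shift. -/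
theorem exists_X_pow_mul_gaussPoly_mem_symmUnimodal (n k : ℕ) :
    ∃ c N, X ^ c * gaussPoly ℤ n k ∈ symmUnimodal N := by
  cases n with
  | zero =>
    cases k with
    | zero => exact ⟨0, 0, by simpa using geom_mem_symmUnimodal 0⟩
    | succ k => exact ⟨0, 0, by simp [zero_mem]⟩
  | succ n =>
    refine ⟨k.choose 2, k * n, ?_⟩
    have hcoeff : ∀ s, (X ^ k.choose 2 * gaussPoly ℤ (n + 1) k).coeff s =
        (#{S ∈ powersetCard k (range (n + 1)) | ∑ x ∈ S, x = s} : ℤ) := by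
      intro s
      rw [← sum_powersetCard_X_pow_sum, finsetSum_coeff]
      simp [coeff_X_pow, eq_comm (a := s)]
    refine mem_symmUnimodal_of_coeff ?_ ?_ ?_ ?_
    · rw [hcoeff]; positivity
    · intro i j h
      rw [hcoeff, hcoeff, card_powersetCard_filter_sum_symm h]
    · intro i hi
      rw [hcoeff, Nat.cast_eq_zero, card_eq_zero, filter_eq_empty_iff]
      rintro S hS rfl
      obtain ⟨hsub, hcard⟩ := mem_powersetCard.1 hS
      refine hi.not_ge ?_
      rw [← hcard, ← smul_eq_mul]
      exact sum_le_card_nsmul _ _ _ fun x hx => Nat.lt_succ_iff.1 (mem_range.1 (hsub hx))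
    · intro i hi
      rw [hcoeff, hcoeff]
      exact_mod_cast card_powersetCard_filter_sum_le hi

end

/-! ### Divisibility by cyclotomic factors, and the two products. -/

section

open Polynomial

/-- Some shift of `p` by a power of the indeterminate is symmetric unimodal. -/
def HasSymmUnimodalShift (p : ℤ[X]) : Prop := ∃ c N, X ^ c * p ∈ symmUnimodal N

lemma HasSymmUnimodalShift.mul {p q : ℤ[X]} (hp : HasSymmUnimodalShift p)
    (hq : HasSymmUnimodalShift q) : HasSymmUnimodalShift (p * q) := by
  obtain ⟨c, M, hp⟩ := hp
  obtain ⟨e, N, hq⟩ := hq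
  refine ⟨c + e, M + N, ?_⟩
  rw [show X ^ (c + e) * (p * q) = X ^ c * p * (X ^ e * q) by ring]
  exact mul_mem_symmUnimodal hp hq

lemma hasSymmUnimodalShift_gaussPoly (n k : ℕ) : HasSymmUnimodalShift (gaussPoly ℤ n k) :=
  exists_X_pow_mul_gaussPoly_mem_symmUnimodal n k

lemma hasSymmUnimodalShift_geom (a : ℕ) :
    HasSymmUnimodalShift (∑ l ∈ Finset.range a, X ^ l) := by
  refine ⟨0, a - 1, ?_⟩
  cases a with
  | zero => simp [zero_mem]
  | succ a => simpa using geom_mem_symmUnimodal a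

/-- If `p` vanishes at all nontrivial `n`-th roots of unity, then `1 - q ^ n` divides
`(1 - q) p`. -/
lemma exists_mul_one_sub_X_pow_eq {n : ℕ} (hn : 0 < n) {p : ℤ[X]}
    (h : ∀ d, 1 < d → d ∣ n → ∀ ζ : ℂ, IsPrimitiveRoot ζ d → p.eval₂ (Int.castRingHom ℂ) ζ = 0) :
    ∃ F : ℤ[X], F * (1 - X ^ n) = (1 - X) * p := by
  -- Distinct cyclotomic polynomials are coprime only over ℚ in general; the product being monic,
  -- divisibility descends to ℤ.
  have hdvd : ∏ d ∈ n.divisors.erase 1, cyclotomic d ℤ ∣ p := by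
    rw [← map_dvd_map (Int.castRingHom ℚ) Int.cast_injective
      (monic_prod_of_monic _ _ fun d _ => cyclotomic.monic d ℤ), Polynomial.map_prod]
    refine Finset.prod_dvd_of_coprime (fun d _ e _ hde => ?_) fun d hd => ?_
    · simp only [Function.onFun, map_cyclotomic]
      exact cyclotomic.isCoprime_rat hde
    · refine Polynomial.map_dvd _ ?_
      obtain ⟨hd1, hd⟩ := Finset.mem_erase.1 hd
      have hd0 := Nat.pos_of_mem_divisors hd
      have hζ := Complex.isPrimitiveRoot_exp d hd0.ne'
      rw [cyclotomic_eq_minpoly hζ hd0]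
      refine minpoly.isIntegrallyClosed_dvd (hζ.isIntegral hd0) ?_
      exact h d (by omega) (Nat.dvd_of_mem_divisors hd) _ hζ
  obtain ⟨F, hF⟩ := hdvd
  refine ⟨F, ?_⟩
  have h1 := prod_cyclotomic_eq_X_pow_sub_one hn ℤ
  rw [← Finset.mul_prod_erase _ _ (Nat.one_mem_divisors.2 hn.ne'), cyclotomic_one] at h1
  rw [hF]
  linear_combination F * h1

lemma isNonnegIntPolynomial_of_mul_eq {n : ℕ} (hn : 0 < n) {p : ℤ[X]}
    (hp : HasSymmUnimodalShift p)
    (h : ∀ d, 1 < d → d ∣ n → ∀ ζ : ℂ, IsPrimitiveRoot ζ d → p.eval₂ (Int.castRingHom ℂ) ζ = 0)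
    {f : RatFunc ℚ} (hf : f * (1 - RatFunc.X ^ n) =
      (1 - RatFunc.X) * algebraMap ℚ[X] (RatFunc ℚ) (p.map (Int.castRingHom ℚ))) :
    IsNonnegIntPolynomial f := by
  obtain ⟨F, hF⟩ := exists_mul_one_sub_X_pow_eq hn h
  obtain ⟨c, N, hp⟩ := hp
  refine ⟨F, coeff_nonneg_of_mul_one_sub_X_pow hn hp hF, ?_⟩
  refine mul_right_cancel₀ (RatFunc.one_sub_X_pow_ne_zero hn.ne') (hf.trans ?_)
  have h1 := congrArg (fun r => algebraMap ℚ[X] (RatFunc ℚ) (r.map (Int.castRingHom ℚ))) hF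
  simpa [RatFunc.algebraMap_X] using h1.symm

lemma Nat.add_mod_eq_or (d x y : ℕ) :
    (x + y) % d = x % d + y % d ∨ (x + y) % d + d = x % d + y % d := by
  rw [Nat.add_mod_eq_ite]
  split_ifs <;> omega

lemma mod_le_mod_of_gaussPoly_eval_ne_zero {d : ℕ} (hd : 0 < d) {ζ : ℂ} (hζ : IsPrimitiveRoot ζ d)
    {a b : ℕ} (h : (gaussPoly ℤ a b).eval₂ (Int.castRingHom ℂ) ζ ≠ 0) : b % d ≤ a % d := by
  by_contra! hlt
  rw [← eval_map, map_gaussPoly] at h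
  exact h (gaussPoly_eval_eq_zero hζ hd hlt)

lemma not_dvd_of_geom_eval_ne_zero {d : ℕ} (hd : 1 < d) {ζ : ℂ} (hζ : IsPrimitiveRoot ζ d)
    {a : ℕ} (h : (∑ l ∈ Finset.range a, (X : ℤ[X]) ^ l).eval₂ (Int.castRingHom ℂ) ζ ≠ 0) :
    ¬ d ∣ a := by
  intro hda
  have h1 := geom_sum_mul ζ a
  rw [(hζ.pow_eq_one_iff_dvd a).2 hda, sub_self] at h1
  refine h ?_
  simpa [eval₂_finsetSum, sub_ne_zero.2 (hζ.ne_one hd)] using h1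

/-- The first product of Gaussian binomials, divided by a `q`-integer. -/
lemma isNonnegIntPolynomial_qBinom_mul_three (m : ℕ) {n k : ℕ} (hkn : k < n) :
    IsNonnegIntPolynomial
      ((1 - (RatFunc.X : RatFunc ℚ) ^ (n - k)) * (1 - (RatFunc.X : RatFunc ℚ) ^ (k + 1)) /
          ((1 - (RatFunc.X : RatFunc ℚ)) * (1 - (RatFunc.X : RatFunc ℚ) ^ n)) *
        qBinom (n + k) (2 * k) * qBinom (m + 1) (k + 1) * qBinom (m + k) (k + 1)) := by
  have hn : 0 < n := by omega
  refine isNonnegIntPolynomial_of_mul_eq hn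
    (p := (∑ l ∈ Finset.range (n - k), X ^ l) * (∑ l ∈ Finset.range (k + 1), X ^ l) *
      gaussPoly ℤ (n + k) (2 * k) * gaussPoly ℤ (m + 1) (k + 1) * gaussPoly ℤ (m + k) (k + 1))
    (((((hasSymmUnimodalShift_geom _).mul (hasSymmUnimodalShift_geom _)).mul
      (hasSymmUnimodalShift_gaussPoly _ _)).mul (hasSymmUnimodalShift_gaussPoly _ _)).mul
      (hasSymmUnimodalShift_gaussPoly _ _)) ?_ ?_
  · intro d hd hdn ζ hζ
    by_contra h
    simp only [eval₂_mul, mul_eq_zero, not_or] at h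
    obtain ⟨⟨⟨⟨h1, h2⟩, h3⟩, h4⟩, h5⟩ := h
    have hd0 : 0 < d := by omega
    have g1 : k % d ≠ 0 := fun h => not_dvd_of_geom_eval_ne_zero hd hζ h1
      (Nat.dvd_sub hdn (Nat.dvd_of_mod_eq_zero h))
    have g2 := mt Nat.dvd_of_mod_eq_zero (not_dvd_of_geom_eval_ne_zero hd hζ h2)
    have g3 := mod_le_mod_of_gaussPoly_eval_ne_zero hd0 hζ h3
    have g4 := mod_le_mod_of_gaussPoly_eval_ne_zero hd0 hζ h4
    have g5 := mod_le_mod_of_gaussPoly_eval_ne_zero hd0 hζ h5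
    rw [two_mul] at g3
    have := Nat.mod_eq_zero_of_dvd hdn
    have := Nat.mod_eq_of_lt hd
    have := Nat.add_mod_eq_or d n k
    have := Nat.add_mod_eq_or d k k
    have := Nat.add_mod_eq_or d k 1
    have := Nat.add_mod_eq_or d m 1
    have := Nat.add_mod_eq_or d m k
    have := Nat.mod_lt k hd0
    have := Nat.mod_lt m hd0
    have := Nat.mod_lt (n + k) hd0
    have := Nat.mod_lt (m + k) hd0
    have := Nat.mod_lt (k + k) hd0
    have := Nat.mod_lt (k + 1) hd0
    have := Nat.mod_lt (m + 1) hd0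
    -- Write κ, μ for k, m mod d. Then 0 < κ < d - 1; `g3` forces 2κ ≥ d and `g4` forces μ ≥ κ, so
    -- (m + k) mod d = μ + κ - d < κ, against `g5`.
    omega
  · have h1 : (1 - RatFunc.X : RatFunc ℚ) ≠ 0 := by
      simpa using RatFunc.one_sub_X_pow_ne_zero (K := ℚ) one_ne_zero
    have h2 := RatFunc.one_sub_X_pow_ne_zero (K := ℚ) hn.ne'
    have e1 := geom_sum_mul (RatFunc.X : RatFunc ℚ) (n - k)
    have e2 := geom_sum_mul (RatFunc.X : RatFunc ℚ) (k + 1)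
    simp only [qBinom_eq_algebraMap, Polynomial.map_mul, Polynomial.map_sum, Polynomial.map_pow,
      map_X, map_gaussPoly, map_mul, map_sum, map_pow, RatFunc.algebraMap_X]
    rw [show (1 - RatFunc.X ^ (n - k) : RatFunc ℚ) =
        (1 - RatFunc.X) * ∑ l ∈ Finset.range (n - k), RatFunc.X ^ l by linear_combination e1,
      show (1 - RatFunc.X ^ (k + 1) : RatFunc ℚ) =
        (1 - RatFunc.X) * ∑ l ∈ Finset.range (k + 1), RatFunc.X ^ l by linear_combination e2]
    field_simp

/-- The second product of Gaussian binomials, divided by a `q`-integer. -/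
lemma isNonnegIntPolynomial_qBinom_mul_six (m n j k : ℕ) :
    IsNonnegIntPolynomial
      ((1 - (RatFunc.X : RatFunc ℚ)) / (1 - (RatFunc.X : RatFunc ℚ) ^ (k + 1)) *
        qBinom (n - 1) k * qBinom (n + k) k * qBinom (2 * k) (j + k) *
        qBinom (m + k) (2 * k) * qBinom m j * qBinom (m + j) j) := by
  have hk : 0 < k + 1 := by omega
  refine isNonnegIntPolynomial_of_mul_eq hk
    (p := gaussPoly ℤ (n - 1) k * gaussPoly ℤ (n + k) k * gaussPoly ℤ (2 * k) (j + k) *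
        gaussPoly ℤ (m + k) (2 * k) * gaussPoly ℤ m j * gaussPoly ℤ (m + j) j)
    ((((((hasSymmUnimodalShift_gaussPoly _ _).mul (hasSymmUnimodalShift_gaussPoly _ _)).mul
      (hasSymmUnimodalShift_gaussPoly _ _)).mul (hasSymmUnimodalShift_gaussPoly _ _)).mul
      (hasSymmUnimodalShift_gaussPoly _ _)).mul (hasSymmUnimodalShift_gaussPoly _ _)) ?_ ?_
  · intro d hd hdk ζ hζ
    by_contra h
    simp only [eval₂_mul, mul_eq_zero, not_or] at h
    obtain ⟨⟨⟨⟨-, h3⟩, h4⟩, h5⟩, h6⟩ := h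
    have hd0 : 0 < d := by omega
    have g3 := mod_le_mod_of_gaussPoly_eval_ne_zero hd0 hζ h3
    have g4 := mod_le_mod_of_gaussPoly_eval_ne_zero hd0 hζ h4
    have g5 := mod_le_mod_of_gaussPoly_eval_ne_zero hd0 hζ h5
    have g6 := mod_le_mod_of_gaussPoly_eval_ne_zero hd0 hζ h6
    rw [two_mul] at g3 g4
    have := Nat.mod_eq_zero_of_dvd hdk
    have := Nat.mod_eq_of_lt hd
    have := Nat.add_mod_eq_or d k 1
    have := Nat.add_mod_eq_or d k k
    have := Nat.add_mod_eq_or d j k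
    have := Nat.add_mod_eq_or d m k
    have := Nat.add_mod_eq_or d m j
    have := Nat.mod_lt k hd0
    have := Nat.mod_lt m hd0
    have := Nat.mod_lt j hd0
    have := Nat.mod_lt (k + k) hd0
    have := Nat.mod_lt (j + k) hd0
    have := Nat.mod_lt (m + k) hd0
    have := Nat.mod_lt (m + j) hd0
    -- Here k ≡ -1 mod d. `g3` excludes j ≡ 0, `g4` leaves m ≡ 0 or -1, and `g5` excludes m ≡ 0.
    -- Then (m + j) mod d = j mod d - 1, against `g6`.
    omega
  · have h2 := RatFunc.one_sub_X_pow_ne_zero (K := ℚ) hk.ne'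
    simp only [qBinom_eq_algebraMap, Polynomial.map_mul, map_gaussPoly, map_mul]
    field_simp

end

theorem theorem2p1 (m n : ℕ) (hm : 0 < m) (hn : 0 < n) (j k : ℕ) :
    IsNonnegIntPolynomial
      ((1 - (RatFunc.X : RatFunc ℚ) ^ ((n : ℤ) - (k : ℤ))) *
          (1 - (RatFunc.X : RatFunc ℚ) ^ (k + 1)) /
          ((1 - (RatFunc.X : RatFunc ℚ)) * (1 - (RatFunc.X : RatFunc ℚ) ^ n)) *
        qBinom (n + k) (2 * k) * qBinom (m + 1) (k + 1) * qBinom (m + k) (k + 1)) ∧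
    IsNonnegIntPolynomial
      ((1 - (RatFunc.X : RatFunc ℚ)) / (1 - (RatFunc.X : RatFunc ℚ) ^ (k + 1)) *
        qBinom (n - 1) k * qBinom (n + k) k * qBinom (2 * k) (j + k) *
        qBinom (m + k) (2 * k) * qBinom m j * qBinom (m + j) j) := by
  refine ⟨?_, isNonnegIntPolynomial_qBinom_mul_six m n j k⟩
  rcases lt_trichotomy k n with h | rfl | h
  · rw [← Nat.cast_sub h.le, zpow_natCast]
    exact isNonnegIntPolynomial_qBinom_mul_three m h
  -- For k = n the factor 1 - q^(n-k) is 0; for k > n the binomial [n+k, 2k] is 0.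
  · exact ⟨0, by simp, by simp⟩
  · refine ⟨0, by simp, ?_⟩
    rw [qBinom, if_neg (by omega)]
    simp
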